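/- A qubit channel is a completely positive, trace-preserving linear map on the complex $2\times 2$ matrices. The average input--output fidelity of a linear map $\mathcal{E}$ on $2\times2$ matrices is $$\overline F(\mathcal{E})=\int d\phi\,\langle\phi|\,\mathcal{E}\big(|\phi\rangle\langle\phi|\big)\,|\phi\rangle,$$ where the integral is over the unit vectors $\phi\in\mathbb{C}^2$ with respect to the unitarily invariant measure normalized by $\int d\phi=1$. A quasi-inverse of a qubit channel $\mathcal{E}$ is a qubit channel $\mathcal{E}^{qi}$ such that $$\overline F(\mathcal{E}^{qi}\circ\mathcal{E})\ge \overline F(\mathcal{E})\quad\text{and}\quad \overline F(\mathcal{E}^{qi}\circ\mathcal{E})\ge \overline F(\mathcal{E}'\circ\mathcal{E})\ \text{ for every qubit channel } \mathcal{E}'.$$ Theorem. The quasi-inverse of any qubit channel can always be taken to be a unitary map: for every qubit channel $\mathcal{E}$ there is a unitary $2\times 2$ matrix $V$ such that the map $\rho\mapsto V\rho V^\dagger$ is a quasi-inverse of $\mathcal{E}$. -/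

import Mathlib

open MeasureTheory
open scoped MatrixOrder Matrix.Norms.L2Operator CStarAlgebra

/-- A quantum channel on a finite-dimensional system: a completely positive and trace preserving
linear map on the matrices, where `A →CP B` is Mathlib's type of completely positive maps between
C⋆-algebras (matrices carry the operator norm and the Loewner order). -/
def IsChannel {n : Type*} [Fintype n] [DecidableEq n]
    (E : Matrix n n ℂ →ₗ[ℂ] Matrix n n ℂ) : Prop :=
  (∃ Φ : Matrix n n ℂ →CP Matrix n n ℂ, Φ.toLinearMap = E) ∧
    ∀ X : Matrix n n ℂ, (E X).trace = X.trace

/-- The unit vectors of `ℂⁿ`: representatives of the pure states. -/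
abbrev PureState (n : Type*) [Fintype n] : Type _ :=
  Metric.sphere (0 : EuclideanSpace ℂ n) 1

/-- The uniform measure on unit vectors of `ℂⁿ`: the surface measure of the sphere,
normalized to total mass `1`. -/
noncomputable def stateMeasure (n : Type*) [Fintype n] : Measure (PureState n) :=
  ((volume : Measure (EuclideanSpace ℂ n)).toSphere Set.univ)⁻¹ •
    (volume : Measure (EuclideanSpace ℂ n)).toSphere

/-- The rank-one projector `|φ⟩⟨φ|`. -/
noncomputable def projector {n : Type*} [Fintype n] (φ : PureState n) : Matrix n n ℂ :=
  Matrix.vecMulVec (φ : EuclideanSpace ℂ n) (star (φ : EuclideanSpace ℂ n).ofLp)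

/-- The input-output fidelity `⟨φ| E(|φ⟩⟨φ|) |φ⟩` of a pure state (for a channel this complex
number is real). -/
noncomputable def fidelity {n : Type*} [Fintype n]
    (E : Matrix n n ℂ →ₗ[ℂ] Matrix n n ℂ) (φ : PureState n) : ℝ :=
  (star (φ : EuclideanSpace ℂ n).ofLp ⬝ᵥ
    (Matrix.mulVec (E (projector φ)) (φ : EuclideanSpace ℂ n).ofLp)).re

/-- The average input-output fidelity `∫ dφ ⟨φ| E(|φ⟩⟨φ|) |φ⟩`. -/
noncomputable def avgFidelity {n : Type*} [Fintype n]
    (E : Matrix n n ℂ →ₗ[ℂ] Matrix n n ℂ) : ℝ :=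
  ∫ φ, fidelity E φ ∂(stateMeasure n)

/-- `Q` is a quasi-inverse of `E`: a channel such that the average fidelity of `Q ∘ E` is at least
that of `E`, and at least that of `E' ∘ E` for every channel `E'`. -/
structure IsQuasiInverse {n : Type*} [Fintype n] [DecidableEq n]
    (Q E : Matrix n n ℂ →ₗ[ℂ] Matrix n n ℂ) : Prop where
  isChannel : IsChannel Q
  le_avgFidelity : avgFidelity E ≤ avgFidelity (Q ∘ₗ E)
  optimal : ∀ E' : Matrix n n ℂ →ₗ[ℂ] Matrix n n ℂ, IsChannel E' →
    avgFidelity (E' ∘ₗ E) ≤ avgFidelity (Q ∘ₗ E)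

/-- The unitary map `ρ ↦ V ρ V†`. -/
def unitaryConj {n : Type*} [Fintype n] [DecidableEq n] (V : Matrix.unitaryGroup n ℂ) :
    Matrix n n ℂ →ₗ[ℂ] Matrix n n ℂ where
  toFun ρ := (V : Matrix n n ℂ) * ρ * (V : Matrix n n ℂ).conjTranspose
  map_add' := by intro x y; simp [mul_add, add_mul]
  map_smul' := by intro c x; simp

/-! Integrating over the sphere turns average fidelity into a trace: `avgFidelity L` is (Tr L + tr
L(1)) / 6, with Tr L the trace of L as a superoperator. For trace-preserving L the second term is 2,
so only Tr(E' ∘ E) has to be maximized. Writing E' in Kraus form gives Tr(E' ∘ E) = ∑ q(K_p), where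
q = `conjTrace E` is a quadratic form in the Kraus operator.

The qubit enters through the spin flip K ↦ K~, an antilinear involution whose fixed points are the
real multiples of unitaries (of determinant 1: the quaternions). Hence K = A + iB with A, B
multiples of unitaries, and the cross terms cancel in q(K) + q(K~) = 2(q(A) + q(B)). If Re q ≤ M on
unitaries, then Re (q(K) + q(K~)) ≤ M tr K†K. Trace preservation of E and E' makes ∑ q(K_p~) = ∑
q(K_p), and ∑ tr K_p†K_p = 2, so Re Tr(E' ∘ E) ≤ M. By compactness some unitary V attains M, and
conjugation by V is optimal. -/

/-! ### Unitary invariance of the measure on the sphere. -/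

/-- The homeomorphism of the unit sphere induced by a linear isometry. -/
noncomputable def LinearIsometryEquiv.sphereHomeomorph {E : Type*} [NormedAddCommGroup E]
    [NormedSpace ℝ E] (f : E ≃ₗᵢ[ℝ] E) :
    Metric.sphere (0 : E) 1 ≃ₜ Metric.sphere (0 : E) 1 :=
  f.toHomeomorph.subtype (fun x => by simp)

theorem LinearIsometryEquiv.coe_sphereHomeomorph {E : Type*} [NormedAddCommGroup E]
    [NormedSpace ℝ E] (f : E ≃ₗᵢ[ℝ] E) (x : Metric.sphere (0 : E) 1) :
    (f.sphereHomeomorph x : E) = f x := rfl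

-- Up to the dimension factor, the surface measure of `s` is the volume of the cone over `s`. A
-- linear isometry commutes with forming cones and preserves volume.
open scoped Pointwise in
theorem LinearIsometryEquiv.measurePreserving_toSphere {E : Type*} [NormedAddCommGroup E]
    [InnerProductSpace ℝ E] [MeasurableSpace E] [BorelSpace E] [FiniteDimensional ℝ E]
    (f : E ≃ₗᵢ[ℝ] E) :
    MeasurePreserving f.sphereHomeomorph (volume : Measure E).toSphere
      (volume : Measure E).toSphere := by
  refine ⟨f.sphereHomeomorph.continuous.measurable, ?_⟩
  ext s hs
  rw [Measure.map_apply f.sphereHomeomorph.continuous.measurable hs,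
    Measure.toSphere_apply' _ (f.sphereHomeomorph.continuous.measurable hs),
    Measure.toSphere_apply' _ hs]
  congr 1
  have h1 : (Subtype.val '' s : Set E) =
      f '' (Subtype.val '' (f.sphereHomeomorph ⁻¹' s)) := by
    ext x
    constructor
    · rintro ⟨y, hy, rfl⟩
      refine ⟨_, ⟨f.sphereHomeomorph.symm y, by simpa using hy, rfl⟩, ?_⟩
      rw [← f.coe_sphereHomeomorph, Homeomorph.apply_symm_apply]
    · rintro ⟨_, ⟨y, hy, rfl⟩, rfl⟩
      exact ⟨_, hy, rfl⟩
  have h2 : Set.Ioo (0 : ℝ) 1 • (Subtype.val '' s : Set E) =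
      f '' (Set.Ioo (0 : ℝ) 1 • (Subtype.val '' (f.sphereHomeomorph ⁻¹' s))) := by
    rw [h1]
    simp only [← Set.image2_smul, Set.image_image2, Set.image2_image_right, map_smul]

  rw [h2]
  conv_lhs => rw [← Set.preimage_image_eq (Set.Ioo (0 : ℝ) 1 • _) f.injective]
  exact f.measurePreserving.measure_preimage_emb f.toHomeomorph.measurableEmbedding _

instance isProbabilityMeasure_stateMeasure (n : Type*) [Fintype n] [Nonempty n] :
    IsProbabilityMeasure (stateMeasure n) := by
  constructor
  rw [stateMeasure, Measure.smul_apply, smul_eq_mul]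
  refine ENNReal.inv_mul_cancel ?_ (measure_ne_top _ _)
  rw [Measure.measure_univ_ne_zero]
  exact Measure.toSphere_ne_zero _

theorem integrable_stateMeasure_of_continuous {n : Type*} [Fintype n] [Nonempty n]
    {F : Type*} [NormedAddCommGroup F] [NormedSpace ℝ F] {g : PureState n → F}
    (hg : Continuous g) : Integrable g (stateMeasure n) :=
  integrableOn_univ.mp (hg.continuousOn.integrableOn_compact isCompact_univ)

/-- The uniform measure on pure states is invariant under unitary matrices. -/
theorem integral_stateMeasure_unitary {n : Type*} [Fintype n] [DecidableEq n]
    {F : Type*} [NormedAddCommGroup F] [NormedSpace ℝ F]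
    (U : Matrix.unitaryGroup n ℂ) (g : (n → ℂ) → F) :
    ∫ φ : PureState n, g ((U : Matrix n n ℂ).mulVec (φ : EuclideanSpace ℂ n).ofLp)
        ∂(stateMeasure n) =
      ∫ φ : PureState n, g (φ : EuclideanSpace ℂ n).ofLp ∂(stateMeasure n) := by
  let f : EuclideanSpace ℂ n ≃ₗᵢ[ℂ] EuclideanSpace ℂ n :=
    Unitary.linearIsometryEquiv ⟨Matrix.toEuclideanCLM (n := n) (𝕜 := ℂ) (U : Matrix n n ℂ), by
      rw [Unitary.mem_iff, ← map_star, ← map_mul, ← map_mul,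
        (Unitary.mem_iff.mp U.2).1, (Unitary.mem_iff.mp U.2).2, map_one]
      exact ⟨rfl, rfl⟩⟩
  let f' : EuclideanSpace ℂ n ≃ₗᵢ[ℝ] EuclideanSpace ℂ n :=
    { f.toLinearEquiv.restrictScalars ℝ with norm_map' := f.norm_map }
  have h := f'.measurePreserving_toSphere.smul_measure
    ((volume : Measure (EuclideanSpace ℂ n)).toSphere Set.univ)⁻¹
  exact h.integral_comp f'.sphereHomeomorph.measurableEmbedding
    (fun φ : PureState n => g (φ : EuclideanSpace ℂ n).ofLp)

/-! ### Fourth moments of a random qubit state. -/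

/-- The fourth moments of the uniform measure on the unit vectors of `ℂ²`. -/
noncomputable def stateMoment (a b i j : Fin 2) : ℂ :=
  ∫ φ : PureState (Fin 2), star ((φ : EuclideanSpace ℂ (Fin 2)).ofLp a) *
    (φ : EuclideanSpace ℂ (Fin 2)).ofLp b * (φ : EuclideanSpace ℂ (Fin 2)).ofLp i *
    star ((φ : EuclideanSpace ℂ (Fin 2)).ofLp j) ∂(stateMeasure (Fin 2))

theorem integrable_stateMoment (a b i j : Fin 2) :
    Integrable (fun φ : PureState (Fin 2) => star ((φ : EuclideanSpace ℂ (Fin 2)).ofLp a) *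
      (φ : EuclideanSpace ℂ (Fin 2)).ofLp b * (φ : EuclideanSpace ℂ (Fin 2)).ofLp i *
      star ((φ : EuclideanSpace ℂ (Fin 2)).ofLp j)) (stateMeasure (Fin 2)) := by
  apply integrable_stateMeasure_of_continuous
  fun_prop

theorem stateMoment_unitary (U : Matrix.unitaryGroup (Fin 2) ℂ) (a b i j : Fin 2) :
    stateMoment a b i j = ∑ a', ∑ b', ∑ i', ∑ j',
      (star ((U : Matrix (Fin 2) (Fin 2) ℂ) a a') * (U : Matrix (Fin 2) (Fin 2) ℂ) b b' *
        (U : Matrix (Fin 2) (Fin 2) ℂ) i i' * star ((U : Matrix (Fin 2) (Fin 2) ℂ) j j')) *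
        stateMoment a' b' i' j' := by
  rw [stateMoment, ← integral_stateMeasure_unitary U
    (fun v => star (v a) * v b * v i * star (v j))]
  simp only [stateMoment, ← integral_const_mul]
  have hI : ∀ a' b' i' j', Integrable (fun φ : PureState (Fin 2) =>
      (star ((U : Matrix (Fin 2) (Fin 2) ℂ) a a') * (U : Matrix (Fin 2) (Fin 2) ℂ) b b' *
        (U : Matrix (Fin 2) (Fin 2) ℂ) i i' * star ((U : Matrix (Fin 2) (Fin 2) ℂ) j j')) *
      (star ((φ : EuclideanSpace ℂ (Fin 2)).ofLp a') *
      (φ : EuclideanSpace ℂ (Fin 2)).ofLp b' * (φ : EuclideanSpace ℂ (Fin 2)).ofLp i' *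
      star ((φ : EuclideanSpace ℂ (Fin 2)).ofLp j'))) (stateMeasure (Fin 2)) :=
    fun a' b' i' j' => (integrable_stateMoment a' b' i' j').const_mul _
  have h4 : ∀ a' b' i', _ := fun a' b' i' =>
    integral_finsetSum (μ := stateMeasure (Fin 2)) Finset.univ (fun j' _ => hI a' b' i' j')
  have h3 : ∀ a' b', _ := fun a' b' =>
    integral_finsetSum (μ := stateMeasure (Fin 2)) Finset.univ
      (fun i' _ => integrable_finsetSum Finset.univ (fun j' _ => hI a' b' i' j'))
  have h2 : ∀ a', _ := fun a' =>
    integral_finsetSum (μ := stateMeasure (Fin 2)) Finset.univ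
      (fun b' _ => integrable_finsetSum Finset.univ
        (fun i' _ => integrable_finsetSum Finset.univ (fun j' _ => hI a' b' i' j')))
  have h1 :=
    integral_finsetSum (μ := stateMeasure (Fin 2)) Finset.univ
      (fun a' _ => integrable_finsetSum Finset.univ
        (fun b' _ => integrable_finsetSum Finset.univ
          (fun i' _ => integrable_finsetSum Finset.univ (fun j' _ => hI a' b' i' j'))))
  simp only [← h4, ← h3, ← h2, ← h1]
  congr 1
  ext φ
  simp only [Matrix.mulVec, dotProduct, Fin.sum_univ_two, star_add, star_mul']
  ring

theorem stateMoment_sum : ∑ a, ∑ b, stateMoment a a b b = 1 := by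
  have h : ∀ φ : PureState (Fin 2), ∑ a, ∑ b, star ((φ : EuclideanSpace ℂ (Fin 2)).ofLp a) *
      (φ : EuclideanSpace ℂ (Fin 2)).ofLp a * (φ : EuclideanSpace ℂ (Fin 2)).ofLp b *
      star ((φ : EuclideanSpace ℂ (Fin 2)).ofLp b) = 1 := by
    intro φ
    have h0 : ‖(φ : EuclideanSpace ℂ (Fin 2))‖ ^ 2 = 1 := by simp
    rw [EuclideanSpace.norm_sq_eq, Fin.sum_univ_two] at h0
    have h1 := congrArg (fun x : ℝ => (x : ℂ) ^ 2) h0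
    simp only [Complex.ofReal_add, ← Complex.normSq_eq_norm_sq, ← Complex.mul_conj] at h1
    simp only [Fin.sum_univ_two, Complex.star_def]
    push_cast at h1
    linear_combination h1
  have h2 := fun a => integral_finsetSum (μ := stateMeasure (Fin 2)) Finset.univ
    (fun b _ => integrable_stateMoment a a b b)
  have h1 := integral_finsetSum (μ := stateMeasure (Fin 2)) Finset.univ
    (fun a _ => integrable_finsetSum Finset.univ (fun b _ => integrable_stateMoment a a b b))
  simp only [stateMoment, ← h2, ← h1, h]
  simp

/-- Unitary invariance and normalization already determine the moments, and three unitaries suffice: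
a phase kills the unbalanced moments, the swap identifies the two basis vectors, and one rotation
relates the remaining two values. -/
theorem stateMoment_eq (a b i j : Fin 2) :
    stateMoment a b i j =
      ((if a = b then 1 else 0) * (if i = j then 1 else 0) +
        (if a = i then 1 else 0) * (if b = j then 1 else 0)) / 6 := by
  let U₁ : Matrix.unitaryGroup (Fin 2) ℂ := ⟨!![Complex.I, 0; 0, 1], by
    rw [Matrix.mem_unitaryGroup_iff]
    ext i j; fin_cases i <;> fin_cases j <;>
    simp [Matrix.mul_apply, Matrix.star_apply]⟩
  let U₂ : Matrix.unitaryGroup (Fin 2) ℂ := ⟨!![0, 1; 1, 0], by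
    rw [Matrix.mem_unitaryGroup_iff]
    ext i j; fin_cases i <;> fin_cases j <;>
    simp [Matrix.mul_apply, Matrix.star_apply]⟩
  let U₃ : Matrix.unitaryGroup (Fin 2) ℂ := ⟨!![3 / 5, -4 / 5; 4 / 5, 3 / 5], by
    rw [Matrix.mem_unitaryGroup_iff]
    ext i j; fin_cases i <;> fin_cases j <;>
    simp [Matrix.mul_apply, Matrix.star_apply, map_ofNat] <;> norm_num⟩
  have hs := stateMoment_sum
  have h₃ := stateMoment_unitary U₃ 0 0 0 0
  have hI := Complex.I_sq
  have e1 : ∀ z : ℂ, z = Complex.I * z → z = 0 := fun z hz => by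
    linear_combination (1 + Complex.I) / 2 * hz + z / 2 * hI
  have e2 : ∀ z : ℂ, z = -(Complex.I * z) → z = 0 := fun z hz => by
    linear_combination (1 - Complex.I) / 2 * hz + z / 2 * hI
  have e3 : ∀ z : ℂ, z = -z → z = 0 := fun z hz => by
    linear_combination hz / 2
  -- `U₁` is diagonal, so invariance multiplies each moment by a single phase; the moment vanishes
  -- when this phase is `I`, `-I` or `-1`.
  have hz : ∀ a b i j, star ((U₁ : Matrix (Fin 2) (Fin 2) ℂ) a a) *
      (U₁ : Matrix (Fin 2) (Fin 2) ℂ) b b * (U₁ : Matrix (Fin 2) (Fin 2) ℂ) i i *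
      star ((U₁ : Matrix (Fin 2) (Fin 2) ℂ) j j) * stateMoment a b i j = stateMoment a b i j := by
    intro a b i j
    refine Eq.trans ?_ (stateMoment_unitary U₁ a b i j).symm
    fin_cases a <;> fin_cases b <;> fin_cases i <;> fin_cases j <;> simp [U₁]
  have m0001 : stateMoment 0 0 0 1 = 0 := e1 _ (by simpa [U₁] using (hz 0 0 0 1).symm)
  have m0010 : stateMoment 0 0 1 0 = 0 := e2 _ (by simpa [U₁] using (hz 0 0 1 0).symm)
  have m0100 : stateMoment 0 1 0 0 = 0 := e2 _ (by simpa [U₁] using (hz 0 1 0 0).symm)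
  have m0110 : stateMoment 0 1 1 0 = 0 := e3 _ (by simpa [U₁] using (hz 0 1 1 0).symm)
  have m0111 : stateMoment 0 1 1 1 = 0 := e2 _ (by simpa [U₁] using (hz 0 1 1 1).symm)
  have m1000 : stateMoment 1 0 0 0 = 0 := e1 _ (by simpa [U₁] using (hz 1 0 0 0).symm)
  have m1001 : stateMoment 1 0 0 1 = 0 := e3 _ (by simpa [U₁] using (hz 1 0 0 1).symm)
  have m1011 : stateMoment 1 0 1 1 = 0 := e1 _ (by simpa [U₁] using (hz 1 0 1 1).symm)
  have m1101 : stateMoment 1 1 0 1 = 0 := e1 _ (by simpa [U₁] using (hz 1 1 0 1).symm)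
  have m1110 : stateMoment 1 1 1 0 = 0 := e2 _ (by simpa [U₁] using (hz 1 1 1 0).symm)
  have p1 : stateMoment 1 1 1 1 = stateMoment 0 0 0 0 := by
    simpa [U₂] using stateMoment_unitary U₂ 1 1 1 1
  have p2 : stateMoment 1 1 0 0 = stateMoment 0 0 1 1 := by
    simpa [U₂] using stateMoment_unitary U₂ 1 1 0 0
  have p3 : ∀ a b i j, stateMoment a b i j = stateMoment a i b j := fun a b i j => by
    simp only [stateMoment]
    congr 1
    ext φ
    ring
  have p4 := p3 0 1 0 1
  have p5 := (p3 1 0 1 0).trans p2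
  simp only [Fin.sum_univ_two] at hs
  simp [U₃, Fin.sum_univ_two, map_ofNat, p1, p2] at h₃
  simp only [m0001, m0010, m0100, m0110, m0111, m1000, m1001, m1011, m1101, m1110, p1, p2, p4, p5] at h₃ hs
  -- With c = 3/5 and s = 4/5, `h₃` reads m = (c⁴ + s⁴) m + 4c²s² x, and 1 - c⁴ - s⁴ = 2c²s² =
  -- 288/625.
  have q1 : stateMoment 0 0 0 0 = 2 * stateMoment 0 0 1 1 := by
    linear_combination (625 / 288) * h₃
  have q2 : stateMoment 0 0 1 1 = 1 / 6 := by
    linear_combination hs / 6 - q1 / 3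
  rw [q2] at q1 p2 p4 p5
  rw [q1] at p1
  fin_cases a <;> fin_cases b <;> fin_cases i <;> fin_cases j <;>
    simp [q1, q2, p1, p2, p4, p5, m0001, m0010, m0100, m0110, m0111, m1000, m1001, m1011, m1101, m1110] <;> norm_num

/-! ### Average fidelity as a superoperator trace. -/

/-- The trace of a linear map on matrices with respect to the matrix units. -/
noncomputable def superTrace {n : Type*} [Fintype n] [DecidableEq n]
    (L : Matrix n n ℂ →ₗ[ℂ] Matrix n n ℂ) : ℂ :=
  ∑ i, ∑ j, L (Matrix.single i j 1) i j

theorem fidelity_eq_sum (L : Matrix (Fin 2) (Fin 2) ℂ →ₗ[ℂ] Matrix (Fin 2) (Fin 2) ℂ)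
    (φ : PureState (Fin 2)) :
    fidelity L φ = (∑ a, ∑ b, ∑ i, ∑ j, L (Matrix.single i j 1) a b *
      (star ((φ : EuclideanSpace ℂ (Fin 2)).ofLp a) *
        (φ : EuclideanSpace ℂ (Fin 2)).ofLp b * (φ : EuclideanSpace ℂ (Fin 2)).ofLp i *
        star ((φ : EuclideanSpace ℂ (Fin 2)).ofLp j))).re := by
  have h : projector φ = ∑ i, ∑ j, ((φ : EuclideanSpace ℂ (Fin 2)).ofLp i *
      star ((φ : EuclideanSpace ℂ (Fin 2)).ofLp j)) • Matrix.single i j (1 : ℂ) := by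
    conv_lhs => rw [Matrix.matrix_eq_sum_single (projector φ)]
    simp [projector, Matrix.vecMulVec_apply]
  have h' : L (projector φ) = ∑ i, ∑ j, ((φ : EuclideanSpace ℂ (Fin 2)).ofLp i *
      star ((φ : EuclideanSpace ℂ (Fin 2)).ofLp j)) • L (Matrix.single i j 1) := by
    rw [h]; simp only [map_sum, map_smul]
  rw [fidelity, h']
  congr 1
  simp only [dotProduct, Matrix.mulVec, Fin.sum_univ_two, Matrix.add_apply,
    Matrix.smul_apply, smul_eq_mul, Pi.star_apply]
  ring

/-- The average fidelity in terms of the trace of the linear map. -/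
theorem avgFidelity_eq (L : Matrix (Fin 2) (Fin 2) ℂ →ₗ[ℂ] Matrix (Fin 2) (Fin 2) ℂ) :
    avgFidelity L = (superTrace L + (L 1).trace).re / 6 := by
  have hI : ∀ a b i j, Integrable (fun φ : PureState (Fin 2) => L (Matrix.single i j 1) a b *
      (star ((φ : EuclideanSpace ℂ (Fin 2)).ofLp a) *
        (φ : EuclideanSpace ℂ (Fin 2)).ofLp b * (φ : EuclideanSpace ℂ (Fin 2)).ofLp i *
        star ((φ : EuclideanSpace ℂ (Fin 2)).ofLp j))) (stateMeasure (Fin 2)) :=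
    fun a b i j => (integrable_stateMoment a b i j).const_mul _
  have h4 := fun a b i =>
    integral_finsetSum (μ := stateMeasure (Fin 2)) Finset.univ (fun j _ => hI a b i j)
  have h3 := fun a b =>
    integral_finsetSum (μ := stateMeasure (Fin 2)) Finset.univ
      (fun i _ => integrable_finsetSum Finset.univ (fun j _ => hI a b i j))
  have h2 := fun a =>
    integral_finsetSum (μ := stateMeasure (Fin 2)) Finset.univ
      (fun b _ => integrable_finsetSum Finset.univ
        (fun i _ => integrable_finsetSum Finset.univ (fun j _ => hI a b i j)))
  have hint := fun a => integrable_finsetSum (μ := stateMeasure (Fin 2)) Finset.univ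
        (fun b _ => integrable_finsetSum Finset.univ
          (fun i _ => integrable_finsetSum Finset.univ (fun j _ => hI a b i j)))
  have h1 := integral_finsetSum (μ := stateMeasure (Fin 2)) Finset.univ (fun a _ => hint a)
  have h0 := integral_re (𝕜 := ℂ) (integrable_finsetSum Finset.univ (fun a _ => hint a))
  simp only [avgFidelity, fidelity_eq_sum]
  refine h0.trans ?_
  rw [h1]
  simp only [h2, h3, h4, integral_const_mul]
  have hm : ∀ a b i j, (∫ φ : PureState (Fin 2), star ((φ : EuclideanSpace ℂ (Fin 2)).ofLp a) *
    (φ : EuclideanSpace ℂ (Fin 2)).ofLp b * (φ : EuclideanSpace ℂ (Fin 2)).ofLp i *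
    star ((φ : EuclideanSpace ℂ (Fin 2)).ofLp j) ∂(stateMeasure (Fin 2))) = _ := stateMoment_eq
  have h1 : (1 : Matrix (Fin 2) (Fin 2) ℂ) = Matrix.single 0 0 1 + Matrix.single 1 1 1 := by
    ext i j; fin_cases i <;> fin_cases j <;> simp
  have h6 : ∀ z : ℂ, z.re / 6 = (z / 6).re := fun z => by
    rw [show (6 : ℂ) = ((6 : ℝ) : ℂ) by simp, Complex.div_ofReal_re]
  rw [h6]
  change Complex.re _ = _
  congr 1
  simp only [hm, superTrace, h1, map_add, Matrix.trace_fin_two, Matrix.add_apply,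
    Fin.sum_univ_two]
  simp
  ring

/-! ### Kraus form from positivity of the Choi matrix. -/

theorem exists_eq_star_mul_self_of_nonneg {A : Type*} [NonUnitalCStarAlgebra A] [PartialOrder A]
    [StarOrderedRing A] {a : A} (ha : 0 ≤ a) : ∃ b, a = star b * b :=
  CStarAlgebra.nonneg_iff_eq_star_mul_self.mp ha

/-- Kraus decomposition of a completely positive map on matrices. -/
theorem CompletelyPositiveMap.exists_kraus {n : Type*} [Fintype n] [DecidableEq n]
    (Φ : Matrix n n ℂ →CP Matrix n n ℂ) :
    ∃ K : n × n → Matrix n n ℂ, ∀ X, Φ X = ∑ p, K p * X * (K p).conjTranspose := by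
  rcases isEmpty_or_nonempty n with hn | ⟨⟨c⟩⟩
  · exact ⟨fun _ => 0, fun X => Subsingleton.elim _ _⟩
  -- A single nonzero block row, chosen so that `star R * R` is the block matrix of all matrix
  -- units. This exhibits it as positive, so its entrywise image under `Φ`, the Choi matrix, is
  -- positive too.
  let R : CStarMatrix n n (Matrix n n ℂ) :=
    CStarMatrix.ofMatrix fun k i => if k = c then Matrix.single c i 1 else 0
  have hR : ∀ i j, (star R * R) i j = Matrix.single i j 1 := by
    intro i j
    rw [CStarMatrix.mul_apply]
    change ∑ k, (if k = c then Matrix.single c i (1 : ℂ) else 0).conjTranspose *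
      (if k = c then Matrix.single c j (1 : ℂ) else 0) = _
    simp [apply_ite Matrix.conjTranspose]
  have h := CompletelyPositiveMap.map_cstarMatrix_nonneg Φ (star R * R) (star_mul_self_nonneg R)
  obtain ⟨b, hb⟩ := exists_eq_star_mul_self_of_nonneg h
  -- Each scalar row of the square root `b` of the Choi matrix, indexed by a block row and a row
  -- inside it, is conjugated and reshaped into one Kraus operator.
  refine ⟨fun p => Matrix.of fun a i => star (b p.1 i p.2 a), fun X => ?_⟩
  have hs : ∀ i j, Φ (Matrix.single i j 1) = ∑ k, (b k i).conjTranspose * b k j := by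
    intro i j
    have e : Φ ((star R * R) i j) = (star b * b) i j := congrFun (congrFun hb i) j
    rw [← hR i j, e, CStarMatrix.mul_apply]
    rfl
  have hX : Φ X = ∑ i, ∑ j, X i j • Φ (Matrix.single i j 1) := by
    conv_lhs => rw [Matrix.matrix_eq_sum_single X]
    simp only [map_sum, ← map_smul]
    simp
  rw [hX]
  ext a a'
  simp only [hs, Matrix.sum_apply, Matrix.smul_apply, Matrix.mul_apply, Fintype.sum_prod_type,
    Matrix.conjTranspose_apply, Matrix.of_apply, star_star, smul_eq_mul, Finset.mul_sum,
    Finset.sum_mul]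
  have swap : ∀ f : n → n → n → n → ℂ,
      ∑ i, ∑ j, ∑ k, ∑ l, f i j k l = ∑ k, ∑ l, ∑ j, ∑ i, f i j k l := by
    intro f
    simp only [← Fintype.sum_prod_type']
    refine Fintype.sum_equiv
      ⟨fun x => (x.2.2.1, x.2.2.2, x.2.1, x.1), fun x => (x.2.2.2, x.2.2.1, x.1, x.2.1),
        fun _ => rfl, fun _ => rfl⟩ _ _ fun _ => rfl
  rw [swap]
  refine Finset.sum_congr rfl fun k _ => Finset.sum_congr rfl fun l _ =>
    Finset.sum_congr rfl fun j _ => Finset.sum_congr rfl fun i _ => ?_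
  ring

/-! ### The spin flip and the quadratic form `conjTrace E`. -/

/-- The spin flip `σ_y K̄ σ_y` of a `2 × 2` matrix. -/
noncomputable def spinFlip (K : Matrix (Fin 2) (Fin 2) ℂ) : Matrix (Fin 2) (Fin 2) ℂ :=
  K.adjugate.conjTranspose

/-- The trace of `ρ ↦ K (E ρ) K†`. -/
noncomputable def conjTrace {n : Type*} [Fintype n] [DecidableEq n]
    (E : Matrix n n ℂ →ₗ[ℂ] Matrix n n ℂ) (K : Matrix n n ℂ) : ℂ :=
  ∑ i, ∑ j, (K * E (Matrix.single i j 1) * K.conjTranspose) i j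

/-- On 2 × 2 matrices Θ(Y) = adj Y = (tr Y)1 - Y is linear and reverses products, so K~ Y K~† = Θ(K
Θ(Y) K†). Taking Y = E(X) with tr E(X) = tr X and tracing over X leaves the stated correction. The
correction cancels when summed over the Kraus operators of a channel. -/
theorem conjTrace_spinFlip {E : Matrix (Fin 2) (Fin 2) ℂ →ₗ[ℂ] Matrix (Fin 2) (Fin 2) ℂ}
    (hE : ∀ X, (E X).trace = X.trace) (K : Matrix (Fin 2) (Fin 2) ℂ) :
    conjTrace E (spinFlip K) = conjTrace E K + (K.conjTranspose * K).trace -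
      (K.conjTranspose * K * E 1).trace := by
  have h1 : (1 : Matrix (Fin 2) (Fin 2) ℂ) = Matrix.single 0 0 1 + Matrix.single 1 1 1 := by
    ext i j; fin_cases i <;> fin_cases j <;> simp
  have t00 := hE (Matrix.single 0 0 1)
  have t01 := hE (Matrix.single 0 1 1)
  have t10 := hE (Matrix.single 1 0 1)
  have t11 := hE (Matrix.single 1 1 1)
  simp only [Matrix.trace_fin_two] at t00 t01 t10 t11
  simp at t00 t01 t10 t11
  rw [← eq_sub_iff_add_eq'] at t00 t11
  rw [add_eq_zero_iff_eq_neg'] at t01 t10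
  simp only [conjTrace, spinFlip, h1, map_add, Matrix.trace_fin_two, Fin.sum_univ_two,
    Matrix.mul_apply, Matrix.conjTranspose_apply, Matrix.adjugate_fin_two, Matrix.add_apply,
    t00, t01, t10, t11]
  simp
  ring

theorem spinFlip_spinFlip (K : Matrix (Fin 2) (Fin 2) ℂ) : spinFlip (spinFlip K) = K := by
  ext i j; fin_cases i <;> fin_cases j <;> simp [spinFlip, Matrix.adjugate_fin_two]

theorem spinFlip_add (K L : Matrix (Fin 2) (Fin 2) ℂ) :
    spinFlip (K + L) = spinFlip K + spinFlip L := by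
  ext i j; fin_cases i <;> fin_cases j <;> simp [spinFlip, Matrix.adjugate_fin_two] <;> ring

theorem spinFlip_smul (c : ℂ) (K : Matrix (Fin 2) (Fin 2) ℂ) :
    spinFlip (c • K) = star c • spinFlip K := by
  ext i j; fin_cases i <;> fin_cases j <;> simp [spinFlip, Matrix.adjugate_fin_two]

theorem conjTrace_smul {n : Type*} [Fintype n] [DecidableEq n]
    (E : Matrix n n ℂ →ₗ[ℂ] Matrix n n ℂ) (c : ℂ) (K : Matrix n n ℂ) :
    conjTrace E (c • K) = (c * star c) * conjTrace E K := by
  simp only [conjTrace, Matrix.conjTranspose_smul, Matrix.smul_mul, Matrix.mul_smul,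
    Matrix.smul_apply, smul_eq_mul, Finset.mul_sum]
  exact Finset.sum_congr rfl fun i _ => Finset.sum_congr rfl fun j _ => by ring

theorem conjTrace_add_add_sub {n : Type*} [Fintype n] [DecidableEq n]
    (E : Matrix n n ℂ →ₗ[ℂ] Matrix n n ℂ) (K L : Matrix n n ℂ) :
    conjTrace E (K + L) + conjTrace E (K - L) = 2 * (conjTrace E K + conjTrace E L) := by
  simp only [conjTrace, ← Finset.sum_add_distrib, Finset.mul_sum]
  refine Finset.sum_congr rfl fun i _ => Finset.sum_congr rfl fun j _ => ?_
  simp only [Matrix.conjTranspose_add, Matrix.conjTranspose_sub, add_mul, mul_add, sub_mul,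
    mul_sub, Matrix.add_apply, Matrix.sub_apply]
  ring

/-- A matrix fixed by the spin flip is a multiple of a unitary matrix. -/
theorem exists_smul_unitary_of_spinFlip_eq {A : Matrix (Fin 2) (Fin 2) ℂ} (hA : spinFlip A = A) :
    ∃ (r : ℝ) (U : Matrix.unitaryGroup (Fin 2) ℂ), A = (r : ℂ) • (U : Matrix (Fin 2) (Fin 2) ℂ) := by
  have h1 : star (A 1 1) = A 0 0 := by
    simpa [spinFlip, Matrix.adjugate_fin_two] using congrFun₂ hA 0 0
  have h2 : A 1 0 = -star (A 0 1) := by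
    simpa [spinFlip, Matrix.adjugate_fin_two] using (congrFun₂ hA 1 0).symm
  -- A fixed point satisfies A† = adj A, so A†A is the scalar det A, which is nonnegative by the
  -- shape of A.
  have h3 : star A * A = A.det • (1 : Matrix (Fin 2) (Fin 2) ℂ) := by
    rw [← Matrix.adjugate_mul, Matrix.star_eq_conjTranspose]
    congr 1
    rw [← hA, spinFlip, Matrix.conjTranspose_conjTranspose, ← spinFlip, hA]
  have h4 : A.det = ((Complex.normSq (A 0 0) + Complex.normSq (A 0 1) : ℝ) : ℂ) := by
    rw [Matrix.det_fin_two, h2, ← star_star (A 1 1), h1]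
    simp [← Complex.mul_conj]
  set d : ℝ := Complex.normSq (A 0 0) + Complex.normSq (A 0 1)
  have hd : 0 ≤ d := add_nonneg (Complex.normSq_nonneg _) (Complex.normSq_nonneg _)
  rcases hd.eq_or_lt with h0 | h0
  · refine ⟨0, 1, ?_⟩
    rw [h4, ← h0, Complex.ofReal_zero, zero_smul,
      CStarRing.star_mul_self_eq_zero_iff] at h3
    simp [h3]
  · have hr : ((Real.sqrt d : ℝ) : ℂ) ≠ 0 := by
      simpa using (Real.sqrt_pos.mpr h0).ne'
    have hrr : (d : ℂ) = (Real.sqrt d : ℝ) * (Real.sqrt d : ℝ) := by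
      rw [← Complex.ofReal_mul, Real.mul_self_sqrt hd]
    refine ⟨Real.sqrt d, ⟨((Real.sqrt d : ℝ) : ℂ)⁻¹ • A, ?_⟩, ?_⟩
    · rw [Matrix.mem_unitaryGroup_iff', star_smul, smul_mul_smul_comm, h3, h4, smul_smul, hrr]
      have : star ((Real.sqrt d : ℝ) : ℂ)⁻¹ = ((Real.sqrt d : ℝ) : ℂ)⁻¹ := by simp
      rw [this]
      field_simp
      simp
    · simp [smul_smul, hr]

/-- A bound on the unitary matrices extends to all `2 × 2` matrices up to the spin flip. -/
theorem conjTrace_add_conjTrace_spinFlip_le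
    (E : Matrix (Fin 2) (Fin 2) ℂ →ₗ[ℂ] Matrix (Fin 2) (Fin 2) ℂ) {M : ℝ}
    (hM : ∀ U : Matrix.unitaryGroup (Fin 2) ℂ, (conjTrace E U).re ≤ M)
    (K : Matrix (Fin 2) (Fin 2) ℂ) :
    (conjTrace E K + conjTrace E (spinFlip K)).re ≤ M * (K.conjTranspose * K).trace.re := by
  -- The factor 1/2 compensates tr U†U = 2.
  have key : ∀ A : Matrix (Fin 2) (Fin 2) ℂ, spinFlip A = A →
      (conjTrace E A).re ≤ M / 2 * (A.conjTranspose * A).trace.re := by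
    intro A hA
    obtain ⟨r, U, rfl⟩ := exists_smul_unitary_of_spinFlip_eq hA
    have hU : (U : Matrix (Fin 2) (Fin 2) ℂ).conjTranspose * U = 1 := (Unitary.mem_iff.mp U.2).1
    rw [conjTrace_smul, Matrix.conjTranspose_smul, smul_mul_smul_comm, hU, Matrix.trace_smul,
      Matrix.trace_one]
    have h := mul_le_mul_of_nonneg_left (hM U) (mul_self_nonneg r)
    simp at h ⊢
    linarith
  -- K = A + iB splits K into parts fixed by the flip. The flip negates K - K~ and is antilinear, so
  -- an imaginary factor makes B fixed.
  set A := (2⁻¹ : ℂ) • (K + spinFlip K) with hA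
  set B := (-Complex.I / 2) • (K - spinFlip K) with hB
  have hA' : spinFlip A = A := by
    rw [hA, spinFlip_smul, spinFlip_add, spinFlip_spinFlip, add_comm]; simp
  have hB' : spinFlip B = B := by
    rw [hB, spinFlip_smul, sub_eq_add_neg, spinFlip_add, ← neg_one_smul ℂ (spinFlip K),
      spinFlip_smul, spinFlip_spinFlip, ← sub_eq_zero]
    ext i j
    simp
    ring
  have h := conjTrace_add_add_sub E K (spinFlip K)
  have hSA : conjTrace E A = conjTrace E (K + spinFlip K) / 4 := by
    rw [hA, conjTrace_smul]; simp; ring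
  have hSB : conjTrace E B = conjTrace E (K - spinFlip K) / 4 := by
    rw [hB, conjTrace_smul]; simp; ring_nf; simp; ring
  have hS : conjTrace E K + conjTrace E (spinFlip K) = 2 * (conjTrace E A + conjTrace E B) := by
    rw [hSA, hSB]; linear_combination -h / 2
  -- The cross terms cancel because tr A†B is real for flip-fixed A and B.
  have hT : (K.conjTranspose * K).trace =
      (A.conjTranspose * A).trace + (B.conjTranspose * B).trace := by
    simp [hA, hB, Matrix.trace_fin_two, Matrix.mul_apply, spinFlip, Matrix.adjugate_fin_two]
    ring_nf
    simp
    ring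
  rw [hS, hT]
  have := key A hA'
  have := key B hB'
  simp only [Complex.mul_re, Complex.add_re, Complex.re_ofNat, Complex.im_ofNat]
  linarith

/-! ### Optimality of a unitary. -/

theorem exists_unitary_conjTrace_max {n : Type*} [Fintype n] [DecidableEq n]
    (E : Matrix n n ℂ →ₗ[ℂ] Matrix n n ℂ) :
    ∃ V : Matrix.unitaryGroup n ℂ, ∀ U : Matrix.unitaryGroup n ℂ,
      (conjTrace E U).re ≤ (conjTrace E V).re := by
  have hc : IsCompact (Matrix.unitaryGroup n ℂ : Set (Matrix n n ℂ)) := by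
    refine Metric.isCompact_of_isClosed_isBounded (isClosed_unitary) ?_
    refine (Metric.isBounded_closedBall (x := (0 : Matrix n n ℂ)) (r := 1)).subset fun U hU => ?_
    rw [mem_closedBall_zero_iff]
    rcases subsingleton_or_nontrivial (Matrix n n ℂ) with h | h
    · simp [Subsingleton.elim U 0]
    · exact (CStarRing.norm_of_mem_unitary hU).le
  have hf : Continuous fun U : Matrix n n ℂ => (conjTrace E U).re := by
    unfold conjTrace
    fun_prop
  obtain ⟨V, hV, h⟩ := hc.exists_isMaxOn ⟨1, one_mem _⟩ hf.continuousOn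
  exact ⟨⟨V, hV⟩, fun U => h U.2⟩

theorem isChannel_unitaryConj {n : Type*} [Fintype n] [DecidableEq n]
    (V : Matrix.unitaryGroup n ℂ) : IsChannel (unitaryConj V) := by
  refine ⟨⟨CompletelyPositiveMapClass.toCompletelyPositiveLinearMap
    (Unitary.conjStarAlgAut ℂ (Matrix n n ℂ) V), rfl⟩, fun X => ?_⟩
  have hV : (V : Matrix n n ℂ).conjTranspose * V = 1 := (Unitary.mem_iff.mp V.2).1
  change ((V : Matrix n n ℂ) * X * (V : Matrix n n ℂ).conjTranspose).trace = X.trace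
  rw [Matrix.trace_mul_comm, ← mul_assoc, hV, one_mul]

theorem unitaryConj_one_comp {n : Type*} [Fintype n] [DecidableEq n]
    (E : Matrix n n ℂ →ₗ[ℂ] Matrix n n ℂ) : unitaryConj 1 ∘ₗ E = E := by
  ext1 X
  simp [unitaryConj]

/-- A bound on `conjTrace E` over the unitary matrices bounds the trace of `E' ∘ E` for every qubit
channel `E'`. -/
theorem superTrace_comp_le {E E' : Matrix (Fin 2) (Fin 2) ℂ →ₗ[ℂ] Matrix (Fin 2) (Fin 2) ℂ}
    (hE : ∀ X, (E X).trace = X.trace) (hE' : IsChannel E') {M : ℝ}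
    (hM : ∀ U : Matrix.unitaryGroup (Fin 2) ℂ, (conjTrace E U).re ≤ M) :
    (superTrace (E' ∘ₗ E)).re ≤ M := by
  obtain ⟨⟨Φ, rfl⟩, ht⟩ := hE'
  obtain ⟨K, hK⟩ := Φ.exists_kraus
  have hK' : ∀ X, Φ.toLinearMap X = ∑ p, K p * X * (K p).conjTranspose := hK
  have htr : ∀ X, ∑ p, ((K p).conjTranspose * K p * X).trace = X.trace := by
    intro X
    rw [← ht X, hK', Matrix.trace_sum]
    exact Finset.sum_congr rfl fun p _ => by rw [mul_assoc, Matrix.trace_mul_comm]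
  have h1 : ∑ p, ((K p).conjTranspose * K p).trace = 2 := by simpa using htr 1
  have hS : superTrace (Φ.toLinearMap ∘ₗ E) = ∑ p, conjTrace E (K p) := by
    simp only [superTrace, conjTrace, LinearMap.comp_apply, hK', Matrix.sum_apply]
    rw [Finset.sum_comm]
    simp only [Finset.sum_comm (s := Finset.univ (α := Fin 2)) (t := Finset.univ (α := Fin 2 × Fin 2))]
    exact Finset.sum_congr rfl fun p _ => Finset.sum_comm
  -- The corrections sum to tr 1 - tr E(1) = 0, by trace preservation of both channels.
  have hflip : ∑ p, conjTrace E (spinFlip (K p)) = ∑ p, conjTrace E (K p) := by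
    simp only [conjTrace_spinFlip hE, Finset.sum_sub_distrib, Finset.sum_add_distrib, h1, htr, hE]
    simp
  have hle := Finset.sum_le_sum fun p (_ : p ∈ Finset.univ) =>
    conjTrace_add_conjTrace_spinFlip_le E hM (K p)
  rw [← Finset.mul_sum, ← Complex.re_sum, ← Complex.re_sum, h1, Finset.sum_add_distrib, hflip,
    ← hS] at hle
  simp at hle
  linarith

theorem theorem1 (E : Matrix (Fin 2) (Fin 2) ℂ →ₗ[ℂ] Matrix (Fin 2) (Fin 2) ℂ)
    (hE : IsChannel E) :
    ∃ V : Matrix.unitaryGroup (Fin 2) ℂ, IsQuasiInverse (unitaryConj V) E := by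
  obtain ⟨V, hV⟩ := exists_unitary_conjTrace_max E
  have hopt : ∀ E', IsChannel E' → avgFidelity (E' ∘ₗ E) ≤ avgFidelity (unitaryConj V ∘ₗ E) := by
    intro E' hE'
    have h1 := superTrace_comp_le hE.2 hE' hV
    have h2 : superTrace (unitaryConj V ∘ₗ E) = conjTrace E V := rfl
    rw [avgFidelity_eq, avgFidelity_eq, LinearMap.comp_apply, LinearMap.comp_apply, hE'.2,
      (isChannel_unitaryConj V).2, h2, Complex.add_re, Complex.add_re]
    linarith
  refine ⟨V, isChannel_unitaryConj V, ?_, hopt⟩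
  -- The identity is itself a competing channel, so optimality yields the comparison with E.
  simpa only [unitaryConj_one_comp] using hopt _ (isChannel_unitaryConj 1)
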